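/- Let $S$ be a Hausdorff topological monoid, i.e. a monoid with a Hausdorff topology for which the multiplication $S\times S\to S$ is (jointly) continuous. Suppose that $S$ is non-viscous: for every neighborhood $U$ of the identity $1$ of $S$ and every $a\in S$ there is a neighborhood $V$ of $a$ such that every $x\in S$ with $(xV\cup Vx)\cap V\ne\emptyset$ belongs to $U$. Suppose further that $S$ is sequentially compact (every sequence has a convergent subsequence), or that the power $S^{2^{\mathfrak c}}$, with the product topology, is countably compact (every infinite subset has an accumulation point), where $\mathfrak c$ is the cardinality of the continuum. Then $S$ is a topological group; that is, every element of $S$ is invertible and the inversion $x\mapsto x^{-1}$ is continuous. -/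

import Mathlib

open scoped Topology Cardinal

/-- A monoid endowed with a topology is *non-viscous* if for every neighbourhood `U` of the
identity and every element `a` there is a neighbourhood `V` of `a` such that every `x` for which
`xV ∪ Vx` meets `V` belongs to `U`. -/
def NonViscous (S : Type*) [Monoid S] [TopologicalSpace S] : Prop :=
  ∀ U ∈ 𝓝 (1 : S), ∀ a : S, ∃ V ∈ 𝓝 a, ∀ x : S,
    ((((fun v => x * v) '' V) ∪ ((fun v => v * x) '' V)) ∩ V).Nonempty → x ∈ U

/-- A monoid endowed with a topology *is a topological group* if its monoid structure is the one
underlying a group structure whose multiplication and inversion are continuous. -/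
def MonoidIsTopologicalGroup (S : Type*) [M : Monoid S] [TopologicalSpace S] : Prop :=
  ∃ G : Group S, G.toDivInvMonoid.toMonoid = M ∧ IsTopologicalGroup S

open Filter

/-! Non-viscosity makes inversion continuous at 1, hence everywhere by translation, so invertibility
of each `a` is the crux. Limits (possibly iterated) of powers of `a` produce 1; the same limits with
one factor `a` removed produce the inverse. Countable compactness of the large power supplies a
single free ultrafilter along which all these limits exist. -/

/-- In a non-viscous T₁ monoid, an element fixing some element by left multiplication is the
identity. -/
theorem NonViscous.eq_one_of_mul_eq_right {S : Type*} [Monoid S] [TopologicalSpace S] [T1Space S]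
    (hS : NonViscous S) {x a : S} (h : x * a = a) : x = 1 := by
  by_contra hx
  obtain ⟨V, hV, hVx⟩ := hS {x}ᶜ (isOpen_compl_singleton.mem_nhds (Ne.symm hx)) a
  exact hVx x ⟨a, Or.inl ⟨a, mem_of_mem_nhds hV, h⟩, mem_of_mem_nhds hV⟩ rfl

/-- Inversion is continuous in a non-viscous group with continuous multiplication. -/
theorem NonViscous.isTopologicalGroup {G : Type*} [Group G] [TopologicalSpace G]
    [ContinuousMul G] (hG : NonViscous G) : IsTopologicalGroup G := by
  have h1 : Tendsto (fun x : G => x⁻¹) (𝓝 1) (𝓝 1) := by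
    intro U hU
    obtain ⟨V, hV, hVU⟩ := hG U hU 1
    refine mem_map.2 ?_
    filter_upwards [hV] with y hy
    exact hVU y⁻¹ ⟨1, Or.inl ⟨y, hy, inv_mul_cancel y⟩, mem_of_mem_nhds hV⟩
  refine { continuous_inv := continuous_iff_continuousAt.2 fun a => ?_ }
  have h2 : Tendsto (fun x : G => a⁻¹ * x) (𝓝 a) (𝓝 1) := by
    simpa using (continuous_const_mul a⁻¹).tendsto a
  have h3 := (h1.comp h2).mul_const a⁻¹
  simpa [ContinuousAt, Function.comp_def] using h3

/-- Every element of a non-viscous, sequentially compact, Hausdorff topological monoid is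
invertible. -/
theorem NonViscous.isUnit_of_seqCompactSpace {S : Type*} [Monoid S] [TopologicalSpace S]
    [T2Space S] [ContinuousMul S] [SeqCompactSpace S] (hS : NonViscous S) (a : S) :
    IsUnit a := by
  obtain ⟨b, φ, hφ, hb⟩ := SeqCompactSpace.tendsto_subseq (fun n : ℕ => a ^ n)
  have h1 : Tendsto (fun n => a ^ (φ (n + 1) - φ n)) atTop (𝓝 1) := by
    intro U hU
    obtain ⟨V, hV, hVU⟩ := hS U hU b
    have hV₁ := hb.eventually_mem hV
    have hV₂ := ((tendsto_add_atTop_iff_nat 1).2 hb).eventually_mem hV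
    refine mem_map.2 ?_
    filter_upwards [hV₁, hV₂] with n hn hn'
    refine hVU _ ⟨a ^ φ (n + 1), Or.inl ⟨a ^ φ n, hn, ?_⟩, hn'⟩
    change a ^ (φ (n + 1) - φ n) * a ^ φ n = a ^ φ (n + 1)
    rw [← pow_add, Nat.sub_add_cancel (hφ n.lt_succ_self).le]
  obtain ⟨c, ψ, hψ, hc⟩ :=
    SeqCompactSpace.tendsto_subseq (fun n : ℕ => a ^ (φ (n + 1) - φ n - 1))
  have h2 := h1.comp hψ.tendsto_atTop
  have hpos : ∀ n, φ (n + 1) - φ n - 1 + 1 = φ (n + 1) - φ n := fun n =>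
    Nat.sub_add_cancel (Nat.sub_pos_of_lt (hφ n.lt_succ_self))
  refine isUnit_iff_exists.2 ⟨c, tendsto_nhds_unique (hc.const_mul a) (h2.congr fun n => ?_),
    tendsto_nhds_unique (hc.mul_const a) (h2.congr fun n => ?_)⟩
  · simp only [Function.comp_apply]
    rw [← pow_succ', hpos]
  · simp only [Function.comp_apply]
    rw [← pow_succ, hpos]

/-- If every sequence converges along a fixed free ultrafilter on `ℕ`, then every element of a
non-viscous Hausdorff topological monoid is invertible. -/
theorem NonViscous.isUnit_of_ultrafilter {S : Type*} [Monoid S] [TopologicalSpace S]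
    [T2Space S] [ContinuousMul S] (hS : NonViscous S) (p : Ultrafilter ℕ)
    (hp : (p : Filter ℕ) ≤ atTop) (hlim : ∀ x : ℕ → S, ∃ y, Tendsto x p (𝓝 y)) (a : S) :
    IsUnit a := by
  obtain ⟨b, hb⟩ := hlim fun n => a ^ n
  -- `c n` stands in for `b * a⁻ⁿ`; truncated subtraction is harmless since `p` is free.
  choose c hc using fun n : ℕ => hlim fun m => a ^ (m - n)
  have hcb : ∀ n, c n * a ^ n = b := fun n =>
    tendsto_nhds_unique ((hc n).mul_const (a ^ n)) <| hb.congr' <| by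
      filter_upwards [hp (eventually_ge_atTop n)] with m hm
      rw [← pow_add, Nat.sub_add_cancel hm]
  have hca : ∀ n, c (n + 1) * a = c n := fun n =>
    tendsto_nhds_unique ((hc (n + 1)).mul_const a) <| (hc n).congr' <| by
      filter_upwards [hp (eventually_ge_atTop (n + 1))] with m hm
      rw [← pow_succ]
      congr 1
      have : n + 1 ≤ m := hm
      omega
  have hac : ∀ n, a * c (n + 1) = c n := fun n =>
    tendsto_nhds_unique ((hc (n + 1)).const_mul a) <| (hc n).congr' <| by
      filter_upwards [hp (eventually_ge_atTop (n + 1))] with m hm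
      rw [← pow_succ']
      congr 1
      have : n + 1 ≤ m := hm
      omega
  obtain ⟨d, hd⟩ := hlim c
  have hd1 : d = 1 := hS.eq_one_of_mul_eq_right (a := b) <|
    tendsto_nhds_unique (hd.mul hb) (tendsto_const_nhds.congr fun n => (hcb n).symm)
  subst hd1
  obtain ⟨e, he⟩ := hlim fun n => c (n + 1)
  exact isUnit_iff_exists.2
    ⟨e, tendsto_nhds_unique (he.const_mul a) (hd.congr fun n => (hac n).symm),
      tendsto_nhds_unique (he.mul_const a) (hd.congr fun n => (hca n).symm)⟩

theorem Cardinal.mk_ultrafilter_nat_le : #(Ultrafilter ℕ) ≤ 2 ^ 𝔠 := by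
  have hinj : Function.Injective (fun p : Ultrafilter ℕ => {s : Set ℕ | s ∈ p}) := fun p q h =>
    Ultrafilter.ext fun s => Set.ext_iff.1 h s
  simpa using Cardinal.mk_le_of_injective hinj

/-- If a power of `X` with exponent of cardinality at least that of the set of ultrafilters on `ℕ`
is countably compact, then all sequences in `X` converge along a common free ultrafilter. -/
theorem exists_ultrafilter_forall_tendsto {X : Type*} [TopologicalSpace X] {ι : Type}
    (hι : #(Ultrafilter ℕ) ≤ #ι) [CountablyCompactSpace (ι → X)] :
    ∃ p : Ultrafilter ℕ, (p : Filter ℕ) ≤ atTop ∧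
      ∀ x : ℕ → X, ∃ y, Tendsto x p (𝓝 y) := by
  by_contra! h
  have h' : ∀ p : Ultrafilter ℕ, ∃ x : ℕ → X,
      (p : Filter ℕ) ≤ atTop → ∀ y, ¬ Tendsto x p (𝓝 y) := fun p => by
    by_cases hp : (p : Filter ℕ) ≤ atTop
    · obtain ⟨x, hx⟩ := h p hp
      exact ⟨x, fun _ => hx⟩
    · obtain ⟨x, -⟩ := h (hyperfilter ℕ) Nat.hyperfilter_le_atTop
      exact ⟨x, fun hp' => absurd hp' hp⟩
  choose x hx using h'
  obtain ⟨f⟩ := Cardinal.le_def _ _ |>.1 hι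
  have hf := Function.leftInverse_invFun f.injective
  -- Diagonal argument: coordinate `f p` carries a sequence that diverges along `p` when `p` is
  -- free, yet a cluster point of the combined sequence gives a free `p` along which all coordinates
  -- converge.
  obtain ⟨y, -, hy⟩ := isCountablyCompact_iff_seq_clusterPt.1
    (CountablyCompactSpace.isCountablyCompact_univ (E := ι → X))
    (fun n i => x (Function.invFun f i) n) (Eventually.of_forall fun _ => Set.mem_univ _)
  obtain ⟨p, hp, hpy⟩ := mapClusterPt_iff_ultrafilter.1 hy
  refine hx p hp (y (f p)) ?_
  have := tendsto_pi_nhds.1 hpy (f p)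
  rwa [hf p] at this

theorem mainTheorem6 (S : Type*) [Monoid S] [TopologicalSpace S] [T2Space S] [ContinuousMul S]
    (hS : NonViscous S)
    (hcpt : SeqCompactSpace S ∨
      ∃ ι : Type, #ι = 2 ^ 𝔠 ∧ CountablyCompactSpace (ι → S)) :
    MonoidIsTopologicalGroup S := by
  have hunit : ∀ a : S, IsUnit a := by
    rcases hcpt with h | ⟨ι, hι, h⟩
    · exact hS.isUnit_of_seqCompactSpace
    · obtain ⟨p, hp, hlim⟩ :=
        exists_ultrafilter_forall_tendsto (X := S) (hι ▸ Cardinal.mk_ultrafilter_nat_le)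
      exact hS.isUnit_of_ultrafilter p hp hlim
  let G : Group S := groupOfIsUnit hunit
  exact ⟨G, rfl, NonViscous.isTopologicalGroup (G := S) hS⟩
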